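/- Consider a repeated second-price auction with $T\ge 2$ rounds. In round $t$ the good has value $v_t\in[0,1]$ for the bidder, the highest competing bid is $m_t\in(0,1]$, and a bid $b\in[0,1]$ earns the (shifted) reward $$g(b,t)=(v_t-m_t)\,\mathbf 1\{b>m_t\}+m_t .$$ A strategy is a possibly randomized rule that chooses each bid $b_t\in[0,1]$ as a measurable function of the bidder's internal randomness and of the feedback from the rounds $s<t$: the bids $b_s$ and $m_s$, together with the value $v_s$ whenever $b_s>m_s$. **Theorem.** For every strategy and every $\Delta^\circ\in(0,1/4)$ with $\lfloor\log_2(1/(2\Delta^\circ))\rfloor\le T$, there exist sequences $v_1,\dots,v_T\in[0,1]$ and $m_1,\dots,m_T\in(0,1]$ such that $\Delta^\circ$ is the smallest positive gap $|m_s-m_t|$ between two of the competing bids and $$\max_{b\in[0,1]}\sum_{t=1}^T g(b,t)-\mathbb E\sum_{t=1}^T g(b_t,t)\;\ge\;\frac1{32}\sqrt{T\,\Big\lfloor\log_2\frac1{2\Delta^\circ}\Big\rfloor},$$ where the sequences are deterministic and the expectation is over the bidder's internal randomness. -/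

import Mathlib

open MeasureTheory

namespace VickreyBandit

/-- The reward of a bid `b` in a round with value `v` and highest competing bid `m`:
`(v - m) 1{b > m} + m`, the net utility of the auction shifted by `m`. -/
noncomputable def gain (v m b : ℝ) : ℝ := (if m < b then v - m else 0) + m

/-- What the bidder learns from a round: his own bid, the highest competing bid, and the value of
the good if he won.  The last entry is `0` if he lost; whether he won can be read off from the
first two entries, so that this entry carries the value exactly when he won. -/
noncomputable def feedback (v m b : ℝ) : ℝ × ℝ × ℝ := (b, m, if m < b then v else 0)

/-- A (possibly randomized) bidding strategy for `T` rounds.  `Ω` is the space of the bidder's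
internal randomness; the bid in round `t` is a measurable function of this randomness and of the
feedback received in the rounds before `t`. -/
structure Strategy (Ω : Type*) [MeasurableSpace Ω] (T : ℕ) where
  bid : (t : Fin T) → Ω → (Fin t.val → ℝ × ℝ × ℝ) → ℝ
  measurable_bid : ∀ t, Measurable (fun x : Ω × (Fin t.val → ℝ × ℝ × ℝ) => bid t x.1 x.2)
  bid_mem : ∀ t ω h, bid t ω h ∈ Set.Icc (0 : ℝ) 1

variable {Ω : Type*} [MeasurableSpace Ω] {T : ℕ}

/-- The bid `b_t` that the strategy places in round `t` when it faces the values `v` and the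
competing bids `m`, as a function of the internal randomness `ω`. -/
noncomputable def play (S : Strategy Ω T) (v m : Fin T → ℝ) (ω : Ω) (t : Fin T) : ℝ :=
  S.bid t ω (fun s : Fin t.val =>
    feedback (v ⟨s.val, s.isLt.trans t.isLt⟩) (m ⟨s.val, s.isLt.trans t.isLt⟩)
      (play S v m ω ⟨s.val, s.isLt.trans t.isLt⟩))
termination_by t.val
decreasing_by exact s.isLt

/-- The regret against the best fixed bid, on the sequences `v` and `m`, of a strategy whose
internal randomness has law `P`:
`max_{b ∈ [0,1]} ∑ₜ g(b, t) - E ∑ₜ g(bₜ, t)`.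
The supremum is a maximum, see `isGreatest_fixedBid`, and the expectation is that of an integrable
random variable, see `integrable_gain_play`. -/
noncomputable def regret (P : Measure Ω) (S : Strategy Ω T) (v m : Fin T → ℝ) : ℝ :=
  (⨆ b : Set.Icc (0 : ℝ) 1, ∑ t, gain (v t) (m t) b) -
    ∫ ω, ∑ t, gain (v t) (m t) (play S v m ω t) ∂P

/-- `Δ` is the smallest positive gap between two of the bids `m`. -/
def IsSmallestGap (m : Fin T → ℝ) (Δ : ℝ) : Prop :=
  IsLeast {d : ℝ | 0 < d ∧ ∃ s t : Fin T, d = |m s - m t|} Δ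

theorem isGreatest_fixedBid (v m : Fin T → ℝ) :
    IsGreatest (Set.range fun b : Set.Icc (0 : ℝ) 1 => ∑ t, gain (v t) (m t) b)
      (⨆ b : Set.Icc (0 : ℝ) 1, ∑ t, gain (v t) (m t) b) := by
  have hfin : (Set.range fun b : Set.Icc (0 : ℝ) 1 => ∑ t, gain (v t) (m t) b).Finite := by
    refine (Set.finite_range (fun p : Fin T → Prop =>
      ∑ t, ((open Classical in if p t then v t - m t else 0) + m t))).subset ?_
    rintro _ ⟨b, rfl⟩
    refine ⟨fun t => m t < b, ?_⟩
    refine Finset.sum_congr rfl fun t _ => ?_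
    unfold gain
    congr
  have hne : (Set.range fun b : Set.Icc (0 : ℝ) 1 => ∑ t, gain (v t) (m t) b).Nonempty :=
    Set.range_nonempty _
  exact ⟨hne.csSup_mem hfin, fun x hx => le_csSup hfin.bddAbove hx⟩

theorem measurable_play (S : Strategy Ω T) (v m : Fin T → ℝ) (t : Fin T) :
    Measurable (fun ω => play S v m ω t) := by
  obtain ⟨k, hk⟩ := t
  induction k using Nat.strong_induction_on with
  | _ k ih =>
    have h : (fun ω => play S v m ω ⟨k, hk⟩) = fun ω => S.bid ⟨k, hk⟩ ω (fun s : Fin k =>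
        feedback (v ⟨s.val, s.isLt.trans hk⟩) (m ⟨s.val, s.isLt.trans hk⟩)
          (play S v m ω ⟨s.val, s.isLt.trans hk⟩)) := by
      funext ω
      rw [play]
    rw [h]
    refine (S.measurable_bid ⟨k, hk⟩).comp (measurable_id.prodMk (measurable_pi_lambda _ ?_))
    intro s
    have hs := ih s.val s.isLt (s.isLt.trans hk)
    refine hs.prodMk (measurable_const.prodMk ?_)
    exact Measurable.ite (measurableSet_lt measurable_const hs) measurable_const measurable_const

theorem integrable_gain_play (P : Measure Ω) [IsProbabilityMeasure P] (S : Strategy Ω T)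
    (v m : Fin T → ℝ) :
    Integrable (fun ω => ∑ t, gain (v t) (m t) (play S v m ω t)) P := by
  refine integrable_finsetSum _ fun t _ => ?_
  have hm : Measurable fun ω => gain (v t) (m t) (play S v m ω t) :=
    (Measurable.ite (measurableSet_lt measurable_const (measurable_play S v m t))
      measurable_const measurable_const).add measurable_const
  refine Integrable.of_bound hm.aestronglyMeasurable (|v t - m t| + |m t|)
    (Filter.Eventually.of_forall fun ω => ?_)
  unfold gain
  rw [Real.norm_eq_abs]
  split_ifs
  · exact abs_add_le _ _
  · simp

end VickreyBandit

/-!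
The values are drawn at random and the competing bids are chosen adaptively, so that every strategy
earns nothing in expectation beyond `∑ m t`, while the best fixed bid profits from the fluctuations.

Let `n = ⌊log₂ (1 / (2 Δ))⌋`, so that the grid `1/4 + Δ j`, `0 ≤ j ≤ 2 ^ n`, lies in `[1/4, 3/4]`.
The rounds are cut into `n` blocks of a common length `L ≥ T / (2 n)`. Throughout a block the
competing bid stays at the midpoint `m` of the current dyadic interval of the grid, and the values
are `m ± 1/4` with independent fair signs. At the end of a block the interval is replaced by its
upper half if the sum of the signs is positive and by its lower half otherwise. The right end of
the last interval is then a bid that wins exactly the blocks with a positive sum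
(`mid_lt_top_iff`), and its total reward is `∑ m t` plus a quarter of the positive parts of the
block sums (`sum_gain_bestBid`).

A bid is chosen before the sign of its round is known, so flipping that sign changes neither the
bid nor the competing bid, and winning has mean zero (`sum_gain_play`). By the second and fourth
moments, a sum of `L` signs has mean absolute value at least `√L / 2` (`sum_abs_walk_ge`). The
regret is therefore at least `n * √L / 16` on average over the signs, hence for some choice of them.

Rounds left over after the blocks have `v t = m t`, which makes them neutral; their competing bid
is one grid step above the last midpoint. The smallest positive gap is `Δ`, because it is the grid
step and is attained: by the last two midpoints if `n ≥ 2`, by a left-over round otherwise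
(`isSmallestGap_price`).
-/

namespace VickreyBandit

/-! ### Sums of random signs -/

/-- The sign `±1` encoded by a Boolean. -/
noncomputable def sgn (b : Bool) : ℝ := if b then 1 else -1

/-- The sign pattern `σ` with the sign at `t` reversed. -/
def flipAt {ι : Type*} [DecidableEq ι] (t : ι) (σ : ι → Bool) : ι → Bool :=
  Function.update σ t (!σ t)

/-- The sum of the signs `σ` over the index set `B`. -/
noncomputable def walk {ι : Type*} (B : Finset ι) (σ : ι → Bool) : ℝ := ∑ t ∈ B, sgn (σ t)

theorem sgn_not (b : Bool) : sgn (!b) = -sgn b := by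
  cases b <;> simp [sgn]

theorem sgn_sq (b : Bool) : sgn b ^ 2 = 1 := by
  cases b <;> simp [sgn]

section Signs

variable {ι : Type*} [DecidableEq ι]

theorem flipAt_same (t : ι) (σ : ι → Bool) : flipAt t σ t = !σ t := by
  simp [flipAt]

theorem flipAt_of_ne {s t : ι} (h : s ≠ t) (σ : ι → Bool) : flipAt t σ s = σ s := by
  simp [flipAt, h]

theorem flipAt_involutive (t : ι) : Function.Involutive (flipAt t) := by
  intro σ
  simp [flipAt]

theorem walk_flipAt {B : Finset ι} {t : ι} (ht : t ∉ B) (σ : ι → Bool) :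
    walk B (flipAt t σ) = walk B σ := by
  refine Finset.sum_congr rfl fun s hs => ?_
  rw [flipAt_of_ne]
  rintro rfl
  exact ht hs

theorem walk_insert {B : Finset ι} {t : ι} (ht : t ∉ B) (σ : ι → Bool) :
    walk (insert t B) σ = sgn (σ t) + walk B σ :=
  Finset.sum_insert ht

variable [Fintype ι]

/-- A fair sign has mean zero, even when weighted by a quantity that does not depend on it. -/
theorem sum_sgn_mul_eq_zero (t : ι) (f : (ι → Bool) → ℝ) (hf : ∀ σ, f (flipAt t σ) = f σ) :
    ∑ σ, sgn (σ t) * f σ = 0 := by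
  have h := Equiv.sum_comp (flipAt_involutive t).toPerm (fun σ : ι → Bool => sgn (σ t) * f σ)
  simp only [Function.Involutive.coe_toPerm, flipAt_same, sgn_not, hf, neg_mul,
    Finset.sum_neg_distrib] at h
  linarith

theorem sum_walk (B : Finset ι) : ∑ σ, walk B σ = 0 := by
  unfold walk
  rw [Finset.sum_comm]
  refine Finset.sum_eq_zero fun t _ => ?_
  simpa using sum_sgn_mul_eq_zero t (fun _ => 1) fun _ => rfl

theorem sum_walk_sq (B : Finset ι) :
    ∑ σ, walk B σ ^ 2 = (Fintype.card (ι → Bool) : ℝ) * B.card := by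
  induction B using Finset.induction_on with
  | empty => simp [walk]
  | insert t B ht ih =>
    have h : ∀ σ, walk (insert t B) σ ^ 2 = walk B σ ^ 2 + 1 + sgn (σ t) * (2 * walk B σ) := by
      intro σ
      rw [walk_insert ht]
      linear_combination sgn_sq (σ t)
    simp_rw [h]
    rw [Finset.sum_add_distrib, Finset.sum_add_distrib, ih, sum_sgn_mul_eq_zero t _
      fun σ => by rw [walk_flipAt ht], Finset.card_insert_of_notMem ht]
    simp
    ring

theorem sum_walk_pow_four_le (B : Finset ι) :
    ∑ σ, walk B σ ^ 4 ≤ (Fintype.card (ι → Bool) : ℝ) * (3 * (B.card : ℝ) ^ 2) := by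
  induction B using Finset.induction_on with
  | empty => simp [walk]
  | insert t B ht ih =>
    have h : ∀ σ, walk (insert t B) σ ^ 4 = walk B σ ^ 4 + 6 * walk B σ ^ 2 + 1
        + sgn (σ t) * (4 * walk B σ ^ 3 + 4 * walk B σ) := by
      intro σ
      rw [walk_insert ht]
      linear_combination (sgn (σ t) ^ 2 + 1 + 4 * sgn (σ t) * walk B σ + 6 * walk B σ ^ 2) *
        sgn_sq (σ t)
    simp_rw [h]
    rw [Finset.sum_add_distrib, Finset.sum_add_distrib, Finset.sum_add_distrib, ← Finset.mul_sum,
      sum_walk_sq, sum_sgn_mul_eq_zero t _ fun σ => by rw [walk_flipAt ht],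
      Finset.card_insert_of_notMem ht]
    have hN : (0 : ℝ) ≤ Fintype.card (ι → Bool) := by positivity
    simp only [Finset.sum_const, Finset.card_univ, nsmul_eq_mul, mul_one, add_zero, Nat.cast_add,
      Nat.cast_one]
    nlinarith

/-- Khinchine's inequality in `L¹`, with a constant that is not the best one. -/
theorem sum_abs_walk_ge (B : Finset ι) :
    (Fintype.card (ι → Bool) : ℝ) * (√B.card / 2) ≤ ∑ σ, |walk B σ| := by
  rcases B.card.eq_zero_or_pos with h0 | hpos
  · rw [h0]
    simpa using Finset.sum_nonneg fun σ _ => abs_nonneg (walk B σ)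
  have hs : 0 < √(B.card : ℝ) := Real.sqrt_pos.2 (by exact_mod_cast hpos)
  set s := √(B.card : ℝ) with hs_def
  have hs2 : s ^ 2 = B.card := Real.sq_sqrt (by positivity)
  -- The cubic `s³ - s² y + 4/27 y³` factors as `(s - 2y/3)² (s + y/3)`, so it is nonnegative.
  have key : ∀ σ, s ^ 2 * walk B σ ^ 2 - 4 / 27 * walk B σ ^ 4 ≤ s ^ 3 * |walk B σ| := by
    intro σ
    have h2 : walk B σ ^ 2 = |walk B σ| ^ 2 := (sq_abs _).symm
    have h4 : walk B σ ^ 4 = |walk B σ| ^ 4 := by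
      rw [show walk B σ ^ 4 = (walk B σ ^ 2) ^ 2 by ring, h2]
      ring
    rw [h2, h4]
    have hy := abs_nonneg (walk B σ)
    generalize |walk B σ| = y at hy
    have : 0 ≤ y * ((s - 2 * y / 3) ^ 2 * (s + y / 3)) := by positivity
    linarith
  have hsum := Finset.sum_le_sum fun σ (_ : σ ∈ Finset.univ) => key σ
  rw [Finset.sum_sub_distrib, ← Finset.mul_sum, ← Finset.mul_sum, ← Finset.mul_sum,
    sum_walk_sq] at hsum
  have h4 := sum_walk_pow_four_le B
  rw [← hs2] at hsum h4
  have hN : (0 : ℝ) ≤ Fintype.card (ι → Bool) := by positivity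
  refine le_of_mul_le_mul_left ?_ (pow_pos hs 3)
  have : 0 ≤ (Fintype.card (ι → Bool) : ℝ) * s ^ 4 := by positivity
  linarith

theorem sum_posPart_walk_ge (B : Finset ι) :
    (Fintype.card (ι → Bool) : ℝ) * (√B.card / 4) ≤ ∑ σ, max (walk B σ) 0 := by
  have h : ∀ σ, max (walk B σ) 0 = |walk B σ| / 2 + walk B σ / 2 := by
    intro σ
    rcases le_total (walk B σ) 0 with h | h
    · rw [max_eq_right h, abs_of_nonpos h]
      ring
    · rw [max_eq_left h, abs_of_nonneg h]
      ring
  simp_rw [h]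
  rw [Finset.sum_add_distrib, ← Finset.sum_div, ← Finset.sum_div, sum_walk]
  have := sum_abs_walk_ge B
  linarith

end Signs

/-! ### Binary search on a dyadic grid -/

open Classical in
/-- The left end, after `k` steps, of the interval of a binary search on `{0, …, 2 ^ n}` that keeps
the upper half in step `k` if `c k` holds and the lower half otherwise. For `k ≤ n` the interval has
length `2 ^ (n - k)`. -/
noncomputable def lowEnd (n : ℕ) (c : ℕ → Prop) : ℕ → ℕ
  | 0 => 0
  | k + 1 => lowEnd n c k + if c k then 2 ^ (n - 1 - k) else 0

/-- The midpoint of the interval of the binary search in step `k < n`. -/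
noncomputable def mid (n : ℕ) (c : ℕ → Prop) (k : ℕ) : ℕ := lowEnd n c k + 2 ^ (n - 1 - k)

section Search

variable {n : ℕ} {c : ℕ → Prop}

theorem lowEnd_mono (n : ℕ) (c : ℕ → Prop) : Monotone (lowEnd n c) :=
  monotone_nat_of_le_succ fun k => by simp [lowEnd]

theorem lowEnd_succ_of_pos {k : ℕ} (h : c k) : lowEnd n c (k + 1) = mid n c k := by
  simp [lowEnd, mid, h]

theorem lowEnd_succ_of_neg {k : ℕ} (h : ¬c k) : lowEnd n c (k + 1) = lowEnd n c k := by
  simp [lowEnd, h]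

theorem lowEnd_add_two_pow {k : ℕ} (hk : k < n) :
    lowEnd n c k + 2 ^ (n - k) = mid n c k + 2 ^ (n - 1 - k) := by
  rw [mid, show n - k = n - 1 - k + 1 by omega, pow_succ]
  ring

theorem highEnd_succ_le {k : ℕ} (hk : k < n) :
    lowEnd n c (k + 1) + 2 ^ (n - (k + 1)) ≤ lowEnd n c k + 2 ^ (n - k) := by
  rw [lowEnd_add_two_pow hk, show n - (k + 1) = n - 1 - k by omega]
  by_cases h : c k
  · rw [lowEnd_succ_of_pos h]
  · rw [lowEnd_succ_of_neg h]
    exact Nat.le_add_right _ _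

theorem highEnd_anti {j k : ℕ} (hjk : j ≤ k) (hk : k ≤ n) :
    lowEnd n c k + 2 ^ (n - k) ≤ lowEnd n c j + 2 ^ (n - j) := by
  induction k, hjk using Nat.le_induction with
  | base => exact le_rfl
  | succ k _ ih => exact (highEnd_succ_le hk).trans (ih (by omega))

theorem highEnd_le {k : ℕ} (hk : k ≤ n) : lowEnd n c k + 2 ^ (n - k) ≤ 2 ^ n := by
  simpa [lowEnd] using highEnd_anti (c := c) (Nat.zero_le k) hk

theorem mid_succ_le {k : ℕ} (hk : k < n) : mid n c k + 1 ≤ 2 ^ n := by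
  have h := highEnd_le (c := c) hk.le
  rw [lowEnd_add_two_pow hk] at h
  have : 0 < 2 ^ (n - 1 - k) := by positivity
  omega

/-- The right end of the last interval lies above exactly those midpoints from which the search
moved up. -/
theorem mid_lt_top_iff {k : ℕ} (hk : k < n) : mid n c k < lowEnd n c n + 1 ↔ c k := by
  refine ⟨fun h => ?_, fun h => ?_⟩
  · by_contra hc
    have h1 := highEnd_anti (c := c) (show k + 1 ≤ n from hk) le_rfl
    rw [lowEnd_succ_of_neg hc, show n - (k + 1) = n - 1 - k by omega, Nat.sub_self, pow_zero] at h1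
    rw [mid] at h
    omega
  · have h1 := lowEnd_mono n c (show k + 1 ≤ n from hk)
    rw [lowEnd_succ_of_pos h] at h1
    omega

theorem lowEnd_congr {c' : ℕ → Prop} {k : ℕ} (h : ∀ j < k, c j ↔ c' j) :
    lowEnd n c k = lowEnd n c' k := by
  induction k with
  | zero => rfl
  | succ k ih =>
    rw [lowEnd, lowEnd, ih fun j hj => h j (by omega)]
    by_cases hc : c k
    · simp [hc, (h k (by omega)).1 hc]
    · simp [hc, mt (h k (by omega)).2 hc]

theorem mid_congr {c' : ℕ → Prop} {k : ℕ} (h : ∀ j < k, c j ↔ c' j) :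
    mid n c k = mid n c' k := by
  rw [mid, mid, lowEnd_congr h]

/-- The last two midpoints of the search are adjacent. -/
theorem mid_adjacent (n : ℕ) (c : ℕ → Prop) :
    mid (n + 2) c n = mid (n + 2) c (n + 1) + 1 ∨ mid (n + 2) c (n + 1) = mid (n + 2) c n + 1 := by
  have h1 : mid (n + 2) c n = lowEnd (n + 2) c n + 2 := by
    simp [mid]
  have h2 : mid (n + 2) c (n + 1) = lowEnd (n + 2) c (n + 1) + 1 := by
    simp [mid]
  by_cases h : c n
  · have := lowEnd_succ_of_pos (n := n + 2) h
    omega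
  · have := lowEnd_succ_of_neg (n := n + 2) h
    omega

end Search

/-! ### The adversary -/

section Adversary

variable {T : ℕ}

/-- The `k`-th block of `L` consecutive rounds. -/
def block (T L k : ℕ) : Finset (Fin T) := Finset.univ.filter fun t => t.val / L = k

/-- Whether the signs in block `k` have a positive sum. -/
def up (L : ℕ) (σ : Fin T → Bool) (k : ℕ) : Prop := 0 < walk (block T L k) σ

/-- The position on the grid of the competing bid in a round: the midpoint of the binary search
during the `n` blocks, and one more than the last midpoint afterwards. -/
noncomputable def pos (n L : ℕ) (σ : Fin T → Bool) (t : Fin T) : ℕ :=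
  if t.val / L < n then mid n (up L σ) (t.val / L) else mid n (up L σ) (n - 1) + 1

/-- The competing bids of the adversary. -/
noncomputable def price (Δ : ℝ) (n L : ℕ) (σ : Fin T → Bool) (t : Fin T) : ℝ :=
  1 / 4 + Δ * pos n L σ t

/-- The values set by the adversary: `1 / 4` above or below the competing bid during the `n` blocks,
according to the sign of the round, and equal to the competing bid afterwards. -/
noncomputable def value (Δ : ℝ) (n L : ℕ) (σ : Fin T → Bool) (t : Fin T) : ℝ :=
  price Δ n L σ t + if t.val / L < n then sgn (σ t) / 4 else 0

/-- The bid at the right end of the last interval of the binary search. -/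
noncomputable def bestBid (Δ : ℝ) (n L : ℕ) (σ : Fin T → Bool) : ℝ :=
  1 / 4 + Δ * (lowEnd n (up L σ) n + 1 : ℕ)

variable {Δ : ℝ} {n L : ℕ}

theorem card_block {k : ℕ} (hL : 0 < L) (hk : k < n) (hnL : n * L ≤ T) :
    (block T L k).card = L := by
  have hkL : (k + 1) * L ≤ T := (Nat.mul_le_mul_right L hk).trans hnL
  have h : (block T L k).map Fin.valEmbedding = Finset.Ico (k * L) ((k + 1) * L) := by
    ext x
    simp only [block, Finset.mem_map, Finset.mem_filter, Finset.mem_univ, true_and,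
      Fin.valEmbedding_apply, Finset.mem_Ico, Nat.div_eq_iff hL]
    constructor
    · rintro ⟨t, ht, rfl⟩
      rw [Nat.succ_mul]
      omega
    · rintro ⟨h1, h2⟩
      rw [Nat.succ_mul] at h2 hkL
      exact ⟨⟨x, by omega⟩, by simp only; omega, rfl⟩
  rw [← Finset.card_map Fin.valEmbedding, h, Nat.card_Ico, Nat.succ_mul, Nat.add_sub_cancel_left]

theorem pos_le (hn : 0 < n) (σ : Fin T → Bool) (t : Fin T) : pos n L σ t ≤ 2 ^ n := by
  rw [pos]
  split_ifs with h
  · exact (Nat.le_succ _).trans (mid_succ_le h)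
  · exact mid_succ_le (by omega)

theorem price_mem (hΔ : 0 < Δ) (hΔn : Δ * 2 ^ n ≤ 1 / 2) (hn : 0 < n) (σ : Fin T → Bool)
    (t : Fin T) : price Δ n L σ t ∈ Set.Icc (1 / 4 : ℝ) (3 / 4) := by
  have h : (pos n L σ t : ℝ) ≤ 2 ^ n := by exact_mod_cast pos_le hn σ t
  have h1 := mul_le_mul_of_nonneg_left h hΔ.le
  have h2 : 0 ≤ Δ * (pos n L σ t : ℝ) := by positivity
  rw [price]
  constructor <;> linarith

theorem value_mem (hΔ : 0 < Δ) (hΔn : Δ * 2 ^ n ≤ 1 / 2) (hn : 0 < n) (σ : Fin T → Bool)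
    (t : Fin T) : value Δ n L σ t ∈ Set.Icc (0 : ℝ) 1 := by
  obtain ⟨h1, h2⟩ := price_mem (L := L) hΔ hΔn hn σ t
  have h3 : sgn (σ t) = 1 ∨ sgn (σ t) = -1 := by
    unfold sgn
    split_ifs <;> simp
  rw [value]
  split_ifs
  · rcases h3 with h | h <;> rw [h] <;> constructor <;> linarith
  · constructor <;> linarith

theorem bestBid_mem (hΔ : 0 < Δ) (hΔn : Δ * 2 ^ n ≤ 1 / 2) (σ : Fin T → Bool) :
    bestBid Δ n L σ ∈ Set.Icc (0 : ℝ) 1 := by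
  have h : ((lowEnd n (up L σ) n + 1 : ℕ) : ℝ) ≤ 2 ^ n := by
    have := highEnd_le (c := up L σ) (le_refl n)
    rw [Nat.sub_self, pow_zero] at this
    exact_mod_cast this
  have h1 := mul_le_mul_of_nonneg_left h hΔ.le
  have h2 : 0 ≤ Δ * ((lowEnd n (up L σ) n + 1 : ℕ) : ℝ) := by positivity
  rw [bestBid]
  constructor <;> linarith

theorem isSmallestGap_of_adjacent (hΔ : 0 < Δ) (σ : Fin T → Bool) {s t : Fin T}
    (hst : pos n L σ s = pos n L σ t + 1) : IsSmallestGap (price Δ n L σ) Δ := by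
  constructor
  · refine ⟨hΔ, s, t, ?_⟩
    rw [price, price, hst]
    push_cast
    rw [show 1 / 4 + Δ * ((pos n L σ t : ℝ) + 1) - (1 / 4 + Δ * (pos n L σ t : ℝ)) = Δ by ring,
      abs_of_pos hΔ]
  · rintro d ⟨hd, a, b, rfl⟩
    have h : price Δ n L σ a - price Δ n L σ b = Δ * ((pos n L σ a - pos n L σ b : ℤ) : ℝ) := by
      rw [price, price]
      push_cast
      ring
    rw [h, abs_mul, abs_of_pos hΔ] at hd ⊢
    have hz : (pos n L σ a - pos n L σ b : ℤ) ≠ 0 := by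
      intro h0
      simp [h0] at hd
    have h1 : (1 : ℝ) ≤ |((pos n L σ a - pos n L σ b : ℤ) : ℝ)| := by
      rw [← Int.cast_abs]
      exact_mod_cast Int.one_le_abs hz
    exact le_mul_of_one_le_right hΔ.le h1

theorem isSmallestGap_price (hΔ : 0 < Δ) (hL : 0 < L) (hn : 0 < n) (hnL : n * L ≤ T)
    (h : 2 ≤ n ∨ n * L < T) (σ : Fin T → Bool) : IsSmallestGap (price Δ n L σ) Δ := by
  have hlt : ∀ k < n, k * L < T := fun k hk =>
    (Nat.mul_lt_mul_of_pos_right hk hL).trans_le hnL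
  -- The round `k * L` is the first of block `k`.
  have hpos : ∀ k (hk : k < n), pos n L σ ⟨k * L, hlt k hk⟩ = mid n (up L σ) k := by
    intro k hk
    simp [pos, Nat.mul_div_cancel k hL, hk]
  rcases h with h2 | h
  · obtain ⟨p, rfl⟩ : ∃ p, n = p + 2 := ⟨n - 2, by omega⟩
    have h0 := hpos p (by omega)
    have h1 := hpos (p + 1) (by omega)
    rcases mid_adjacent p (up L σ) with hm | hm
    · exact isSmallestGap_of_adjacent hΔ σ (h0.trans (hm.trans (congrArg (· + 1) h1.symm)))
    · exact isSmallestGap_of_adjacent hΔ σ (h1.trans (hm.trans (congrArg (· + 1) h0.symm)))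
  · have h1 := hpos (n - 1) (by omega)
    refine isSmallestGap_of_adjacent (s := ⟨n * L, h⟩) hΔ σ (Eq.trans ?_ (congrArg (· + 1) h1.symm))
    simp [pos, Nat.mul_div_cancel n hL]

/-! ### The best fixed bid -/

/-- During the blocks, the distinguished bid wins a round exactly if its block has a positive sum
of signs. -/
theorem price_lt_bestBid_iff (hΔ : 0 < Δ) (σ : Fin T → Bool) {t : Fin T} (ht : t.val / L < n) :
    price Δ n L σ t < bestBid Δ n L σ ↔ up L σ (t.val / L) := by
  rw [price, bestBid, add_lt_add_iff_left, mul_lt_mul_iff_right₀ hΔ, Nat.cast_lt, pos, if_pos ht,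
    mid_lt_top_iff ht]

theorem sum_gain_bestBid (hΔ : 0 < Δ) (σ : Fin T → Bool) :
    ∑ t, gain (value Δ n L σ t) (price Δ n L σ t) (bestBid Δ n L σ) =
      (∑ k ∈ Finset.range n, max (walk (block T L k) σ) 0) / 4 + ∑ t, price Δ n L σ t := by
  classical
  unfold gain
  rw [Finset.sum_add_distrib]
  congr 1
  have h : ∀ t : Fin T, (if price Δ n L σ t < bestBid Δ n L σ then
      value Δ n L σ t - price Δ n L σ t else 0) =
      ∑ k ∈ Finset.range n,
        if t.val / L = k then (if up L σ k then sgn (σ t) / 4 else 0) else 0 := by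
    intro t
    rw [Finset.sum_ite_eq, value, add_sub_cancel_left]
    by_cases ht : t.val / L < n
    · simp [ht, price_lt_bestBid_iff hΔ σ ht]
    · simp [ht]
  simp_rw [h]
  rw [Finset.sum_comm, Finset.sum_div]
  refine Finset.sum_congr rfl fun k _ => ?_
  rw [← Finset.sum_filter]
  change ∑ t ∈ block T L k, _ = _
  by_cases hk : up L σ k
  · simp only [hk, if_true]
    rw [← Finset.sum_div, max_eq_left hk.le]
    rfl
  · simp only [hk, if_false, Finset.sum_const_zero]
    rw [max_eq_right (not_lt.1 hk), zero_div]

/-! ### The strategy earns nothing on average -/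

/-- A bid depends on the values and the competing bids of the earlier rounds only. -/
theorem play_congr {Ω : Type*} [MeasurableSpace Ω] (S : Strategy Ω T) {v m v' m' : Fin T → ℝ}
    (ω : Ω) (t : Fin T) (h : ∀ s < t, v s = v' s ∧ m s = m' s) :
    play S v m ω t = play S v' m' ω t := by
  obtain ⟨k, hk⟩ := t
  induction k using Nat.strong_induction_on with
  | _ k ih =>
    rw [play, play]
    congr 1
    funext s
    have hs : (⟨s.val, s.isLt.trans hk⟩ : Fin T) < ⟨k, hk⟩ := s.isLt
    rw [ih s.val s.isLt (s.isLt.trans hk) fun r hr => h r (hr.trans hs), (h _ hs).1, (h _ hs).2]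

theorem price_flipAt {s t : Fin T} (hst : s ≤ t) (ht : t.val / L < n) (σ : Fin T → Bool) :
    price Δ n L (flipAt t σ) s = price Δ n L σ s := by
  have hs : s.val / L ≤ t.val / L := Nat.div_le_div_right hst
  rw [price, price, pos, pos, if_pos (hs.trans_lt ht), if_pos (hs.trans_lt ht),
    mid_congr fun j hj => ?_]
  rw [up, up, walk_flipAt]
  simp only [block, Finset.mem_filter, Finset.mem_univ, true_and]
  omega

theorem value_flipAt {s t : Fin T} (hst : s < t) (ht : t.val / L < n) (σ : Fin T → Bool) :
    value Δ n L (flipAt t σ) s = value Δ n L σ s := by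
  rw [value, value, price_flipAt hst.le ht, flipAt_of_ne hst.ne]

/-- Summed over all sign patterns, winning a round brings nothing. -/
theorem sum_gain_play {Ω : Type*} [MeasurableSpace Ω] (S : Strategy Ω T) (Δ : ℝ) (n L : ℕ)
    (ω : Ω) :
    ∑ σ : Fin T → Bool, ∑ t, gain (value Δ n L σ t) (price Δ n L σ t)
        (play S (value Δ n L σ) (price Δ n L σ) ω t) =
      ∑ σ : Fin T → Bool, ∑ t, price Δ n L σ t := by
  rw [Finset.sum_comm, Finset.sum_comm (s := (Finset.univ : Finset (Fin T → Bool)))]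
  refine Finset.sum_congr rfl fun t _ => ?_
  unfold gain
  rw [Finset.sum_add_distrib, add_eq_right]
  by_cases ht : t.val / L < n
  · have h : ∀ σ : Fin T → Bool,
        (if price Δ n L σ t < play S (value Δ n L σ) (price Δ n L σ) ω t then
          value Δ n L σ t - price Δ n L σ t else 0) =
        sgn (σ t) *
          (if price Δ n L σ t < play S (value Δ n L σ) (price Δ n L σ) ω t then 1 / 4 else 0) := by
      intro σ
      rw [value, if_pos ht, add_sub_cancel_left]
      split_ifs <;> ring
    simp_rw [h]
    refine sum_sgn_mul_eq_zero t _ fun σ => ?_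
    rw [price_flipAt le_rfl ht, play_congr S ω t fun s hs =>
      ⟨value_flipAt hs ht σ, price_flipAt hs.le ht σ⟩]
  · simp [value, ht]

theorem sum_integral_gain_play {Ω : Type*} [MeasurableSpace Ω] (P : Measure Ω)
    [IsProbabilityMeasure P] (S : Strategy Ω T) (Δ : ℝ) (n L : ℕ) :
    ∑ σ : Fin T → Bool, ∫ ω, ∑ t, gain (value Δ n L σ t) (price Δ n L σ t)
        (play S (value Δ n L σ) (price Δ n L σ) ω t) ∂P =
      ∑ σ : Fin T → Bool, ∑ t, price Δ n L σ t := by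
  rw [← integral_finsetSum _ fun σ _ => integrable_gain_play P S _ _]
  simp_rw [sum_gain_play]
  simp

/-! ### The average regret -/

theorem regret_ge {Ω : Type*} [MeasurableSpace Ω] (P : Measure Ω) (S : Strategy Ω T)
    (v m : Fin T → ℝ) {b : ℝ} (hb : b ∈ Set.Icc (0 : ℝ) 1) :
    ∑ t, gain (v t) (m t) b - ∫ ω, ∑ t, gain (v t) (m t) (play S v m ω t) ∂P ≤ regret P S v m :=
  sub_le_sub_right ((isGreatest_fixedBid v m).2 ⟨⟨b, hb⟩, rfl⟩) _

theorem exists_regret_ge {Ω : Type*} [MeasurableSpace Ω] (P : Measure Ω) [IsProbabilityMeasure P]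
    (S : Strategy Ω T) (hΔ : 0 < Δ) (hΔn : Δ * 2 ^ n ≤ 1 / 2) (hL : 0 < L) (hnL : n * L ≤ T) :
    ∃ σ : Fin T → Bool, n * √L / 16 ≤ regret P S (value Δ n L σ) (price Δ n L σ) := by
  have hsum : (∑ _σ : Fin T → Bool, n * √L / 16 : ℝ) ≤
      ∑ σ : Fin T → Bool, regret P S (value Δ n L σ) (price Δ n L σ) := by
    refine le_trans ?_ (Finset.sum_le_sum fun σ _ =>
      regret_ge P S _ _ (bestBid_mem (L := L) hΔ hΔn σ))
    simp_rw [sum_gain_bestBid hΔ]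
    rw [Finset.sum_sub_distrib, sum_integral_gain_play, Finset.sum_add_distrib,
      add_sub_cancel_right, Finset.sum_const, Finset.card_univ, nsmul_eq_mul, ← Finset.sum_div,
      Finset.sum_comm]
    have h : ∑ _k ∈ Finset.range n, (Fintype.card (Fin T → Bool) : ℝ) * (√L / 4) ≤
        ∑ k ∈ Finset.range n, ∑ σ : Fin T → Bool, max (walk (block T L k) σ) 0 := by
      refine Finset.sum_le_sum fun k hk => ?_
      have := sum_posPart_walk_ge (block T L k)
      rwa [card_block hL (Finset.mem_range.1 hk) hnL] at this
    rw [Finset.sum_const, Finset.card_range, nsmul_eq_mul] at h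
    linarith
  obtain ⟨σ, -, hσ⟩ := Finset.exists_le_of_sum_le Finset.univ_nonempty hsum
  exact ⟨σ, hσ⟩

end Adversary

theorem mul_two_pow_floor_logb_le {Δ : ℝ} (hΔ : Δ ∈ Set.Ioo (0 : ℝ) (1 / 4)) :
    Δ * 2 ^ ⌊Real.logb 2 (1 / (2 * Δ))⌋₊ ≤ 1 / 2 := by
  obtain ⟨h0, h1⟩ := hΔ
  have hx : (1 : ℝ) ≤ 1 / (2 * Δ) := by
    rw [le_div_iff₀ (by positivity)]
    linarith
  have h := Nat.floor_le (Real.logb_nonneg one_lt_two hx)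
  rw [Real.le_logb_iff_rpow_le one_lt_two (by positivity), Real.rpow_natCast,
    le_div_iff₀ (by positivity)] at h
  linarith

theorem floor_logb_pos {Δ : ℝ} (hΔ : Δ ∈ Set.Ioo (0 : ℝ) (1 / 4)) :
    0 < ⌊Real.logb 2 (1 / (2 * Δ))⌋₊ := by
  obtain ⟨h0, h1⟩ := hΔ
  rw [Nat.floor_pos, Real.le_logb_iff_rpow_le one_lt_two (by positivity), Real.rpow_one,
    le_div_iff₀ (by positivity)]
  linarith

/-- The length of the blocks. A single block has to leave a round over, so that two different
competing bids occur. -/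
theorem exists_block_length {T n : ℕ} (hT : 2 ≤ T) (hn : 0 < n) (hnT : n ≤ T) :
    ∃ L, 0 < L ∧ n * L ≤ T ∧ T ≤ 2 * (n * L) ∧ (2 ≤ n ∨ n * L < T) := by
  rcases (show n = 1 ∨ 2 ≤ n by omega) with rfl | h2
  · exact ⟨T - 1, by omega, by omega, by omega, by omega⟩
  · have hL : 0 < T / n := Nat.div_pos hnT hn
    refine ⟨T / n, hL, Nat.mul_div_le T n, ?_, Or.inl h2⟩
    have h1 := Nat.lt_mul_div_succ T hn
    have h3 : n ≤ n * (T / n) := Nat.le_mul_of_pos_right n hL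
    rw [Nat.mul_succ] at h1
    omega

end VickreyBandit

theorem mainTheorem6 {Ω : Type*} [MeasurableSpace Ω] (P : Measure Ω) [IsProbabilityMeasure P]
    {T : ℕ} (hT : 2 ≤ T) (S : VickreyBandit.Strategy Ω T)
    (Δ : ℝ) (hΔ : Δ ∈ Set.Ioo (0 : ℝ) (1 / 4)) (hn : ⌊Real.logb 2 (1 / (2 * Δ))⌋₊ ≤ T) :
    ∃ v m : Fin T → ℝ, (∀ t, v t ∈ Set.Icc (0 : ℝ) 1) ∧ (∀ t, m t ∈ Set.Ioc (0 : ℝ) 1) ∧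
      VickreyBandit.IsSmallestGap m Δ ∧
      (1 / 32) * √((T : ℝ) * (⌊Real.logb 2 (1 / (2 * Δ))⌋₊ : ℝ)) ≤
        VickreyBandit.regret P S v m := by
  have hn0 := VickreyBandit.floor_logb_pos hΔ
  have hΔn := VickreyBandit.mul_two_pow_floor_logb_le hΔ
  set n := ⌊Real.logb 2 (1 / (2 * Δ))⌋₊
  obtain ⟨L, hL, hnL, hTL, hgap⟩ := VickreyBandit.exists_block_length hT hn0 hn
  obtain ⟨σ, hσ⟩ := VickreyBandit.exists_regret_ge P S hΔ.1 hΔn hL hnL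
  refine ⟨VickreyBandit.value Δ n L σ, VickreyBandit.price Δ n L σ,
    VickreyBandit.value_mem hΔ.1 hΔn hn0 σ, fun t => ?_,
    VickreyBandit.isSmallestGap_price hΔ.1 hL hn0 hnL hgap σ, le_trans ?_ hσ⟩
  · obtain ⟨h1, h2⟩ := VickreyBandit.price_mem (L := L) hΔ.1 hΔn hn0 σ t
    constructor <;> linarith
  · have hTL' : (T : ℝ) ≤ 2 * (n * L) := by exact_mod_cast hTL
    have h : √((T : ℝ) * n) ≤ 2 * (n * √(L : ℝ)) := by
      refine Real.sqrt_le_iff.2 ⟨by positivity, ?_⟩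
      have h1 : (2 * (n * √(L : ℝ))) ^ 2 = 4 * (n ^ 2 * L) := by
        rw [mul_pow, mul_pow, Real.sq_sqrt (by positivity)]
        ring
      rw [h1]
      have h2 : (T : ℝ) * n ≤ 2 * (n * L) * n := by gcongr
      have h3 : (0 : ℝ) ≤ n ^ 2 * L := by positivity
      linarith
    linarith
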